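/- For $\sigma>0$ let $\mathcal B_\sigma$ be the set of entire functions $f$ such that for every $\epsilon>0$ there is a constant $C$ with $|f(z)|\le C e^{(\sigma+\epsilon)|z|}$ for all $z\in\mathbb C$, and let $\mathcal B^p_\sigma$ be the set of all $f\in\mathcal B_\sigma$ with $f|_{\mathbb R}\in L^p(\mathbb R)$. A sine-type function is a function $\varphi\in\mathcal B_\pi$ with simple and uniformly separated zeros for which there are constants $A,B,H>0$ with $A e^{\pi|\eta|}\le|\varphi(\xi+i\eta)|\le B e^{\pi|\eta|}$ for all $\xi\in\mathbb R$ and $|\eta|\ge H$. A finite family of vectors in $\mathbb C^K$ is a 2-uniform $A$-tight frame if $\sum_m|\langle x,a_m\rangle|^2=A\|x\|^2$ for all $x$, all $\|a_m\|$ are equal, and $|\langle a_m,a_j\rangle|$ takes the same value for all $m\ne j$. Let $K\ge2$ be an integer, $\beta>0$, $\lambda_1,\dots,\lambda_K\in\mathbb C$ and $\alpha_{k,m}\in\mathbb C$ ($1\le k\le K$, $1\le m\le K^2$), and put $$\gamma_{n,m}(f)=\sum_{k=1}^K\overline{\alpha_{k,m}}\,f(n\beta+\lambda_k),\qquad n\in\mathbb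 Z,\ m=1,\dots,K^2 .$$ These functionals satisfy the recovery condition if (1) $\lambda_K=\lambda_1+\beta$, (2) $\{n\beta+\lambda_k: n\in\mathbb Z,\ 1\le k\le K-1\}$ is the zero set of a sine-type function, and (3) the vectors $a_m=(\alpha_{1,m},\dots,\alpha_{K,m})$, $m=1,\dots,K^2$, form a 2-uniform $K^2/K$-tight frame for $\mathbb C^K$. Theorem. (a) Suppose that the functionals $\gamma_{n,m}$ satisfy the recovery condition and let $1<p<\infty$. Then every $f\in\mathcal B^p_\pi$ with $f(n\beta+\lambda_1)\neq0$ for all $n\in\mathbb Z$ is determined by the intensities $|\gamma_{n,m}(f)|^2$ ($n\in\mathbb Z$, $1\le m\le K^2$) up to a global unimodular factor: if $g\in\mathcal B^p_\pi$ and $|\gamma_{n,m}(g)|^2=|\gamma_{n,m}(f)|^2$ for all $n,m$, then $g=c\,f$ for some $c\in\mathbb C$ with $|c|=1$. (b) The smallest overall sampling rate $R=K^2/\beta$ over all $K\ge2$, $\beta>0$, $\lambda_k$, $\alpha_{k,m}$ that satisfy the recovery condition is attained and equals four times the Nyquist rate; the Nyquist rate of $\mathcal B_\pi$ is $1$, so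 this minimum is $4$. -/

import Mathlib

namespace PhaseRetrieval

/-- Entire functions of exponential type at most `σ`: for every `ε > 0` there is a constant `C`
with `|f z| ≤ C e^{(σ + ε)|z|}` on all of `ℂ`. -/
def EntireOfExpType (σ : ℝ) (f : ℂ → ℂ) : Prop :=
  Differentiable ℂ f ∧
    ∀ ε : ℝ, 0 < ε → ∃ C : ℝ, ∀ z : ℂ, ‖f z‖ ≤ C * Real.exp ((σ + ε) * ‖z‖)

/-- The Bernstein space `B^p_σ`: entire functions of exponential type at most `σ` whose
restriction to the real axis belongs to `L^p(ℝ)`. -/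
def BernsteinSpace (p : ENNReal) (σ : ℝ) : Set (ℂ → ℂ) :=
  {f | EntireOfExpType σ f ∧ MeasureTheory.MemLp (fun t : ℝ => f (t : ℂ)) p MeasureTheory.volume}

/-- Sine-type functions (bandwidth normalized to `π`): entire functions of exponential type `π`
with simple and separated zeros and with `A e^{π|η|} ≤ |φ(ξ + iη)| ≤ B e^{π|η|}` for all real `ξ`
and all `|η| ≥ H`, where `A`, `B`, `H` are positive constants. (The lower estimate makes
the exponential type equal to `π`.) -/
structure IsSineType (φ : ℂ → ℂ) : Prop where
  expType : EntireOfExpType Real.pi φ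
  simple_zeros : ∀ z : ℂ, φ z = 0 → deriv φ z ≠ 0
  separated_zeros : ∃ δ : ℝ, 0 < δ ∧
    ∀ z w : ℂ, φ z = 0 → φ w = 0 → z ≠ w → δ ≤ ‖z - w‖
  growth : ∃ A B H : ℝ, 0 < A ∧ 0 < B ∧ 0 < H ∧ ∀ z : ℂ, H ≤ |z.im| →
    A * Real.exp (Real.pi * |z.im|) ≤ ‖φ z‖ ∧ ‖φ z‖ ≤ B * Real.exp (Real.pi * |z.im|)

/-- A finite family `a` in `ℂ^K` is a 2-uniform `A`-tight frame if it is a tight frame with frame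
constant `A`, all its vectors have the same norm, and it is equiangular, that is
`|⟨a i, a j⟩|` has the same value for all `i ≠ j`. -/
structure IsTwoUniformTightFrame {ι : Type*} [Fintype ι] {K : ℕ} (A : ℝ)
    (a : ι → EuclideanSpace ℂ (Fin K)) : Prop where
  tight : ∀ x : EuclideanSpace ℂ (Fin K), ∑ i, ‖inner ℂ (a i) x‖ ^ 2 = A * ‖x‖ ^ 2
  uniform : ∃ b : ℝ, ∀ i, ‖a i‖ = b
  equiangular : ∃ c : ℝ, ∀ i j, i ≠ j → ‖inner ℂ (a i) (a j)‖ = c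

/-- The measurement functionals
`γ_{n,m}(f) = ∑_k conj(α_{k,m}) f(nβ + λ_k)`, `n ∈ ℤ`, `m = 1, …, K²`. The indices
`k = 1, …, K` and `m = 1, …, K²` of the text are shifted to start at `0`. -/
noncomputable def measurement {K : ℕ} (β : ℝ) (lam : Fin K → ℂ) (α : Fin K → Fin (K ^ 2) → ℂ)
    (n : ℤ) (m : Fin (K ^ 2)) (f : ℂ → ℂ) : ℂ :=
  ∑ k : Fin K, (starRingEnd ℂ) (α k m) * f ((n : ℂ) * (β : ℂ) + lam k)

/-- The coefficient vectors `a_m = (α_{1,m}, …, α_{K,m})`. -/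
noncomputable def coeffVector {K : ℕ} (α : Fin K → Fin (K ^ 2) → ℂ) (m : Fin (K ^ 2)) :
    EuclideanSpace ℂ (Fin K) :=
  WithLp.toLp 2 (fun k => α k m)

/-- The sampling set `{nβ + λ_k : n ∈ ℤ, k = 1, …, K - 1}`, which leaves out the last
index `k = K`. -/
def samplingSet {K : ℕ} (β : ℝ) (lam : Fin K → ℂ) : Set ℂ :=
  {z | ∃ (n : ℤ) (k : Fin K), (k : ℕ) + 1 < K ∧ z = (n : ℂ) * (β : ℂ) + lam k}

/-- The recovery condition: `λ_K = λ_1 + β`, the sampling set is the zero set of a sine-type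
function, and the coefficient vectors form a 2-uniform `K²/K`-tight frame for `ℂ^K`. -/
structure RecoveryCondition {K : ℕ} (hK : 2 ≤ K) (β : ℝ) (lam : Fin K → ℂ)
    (α : Fin K → Fin (K ^ 2) → ℂ) : Prop where
  overlap : lam ⟨K - 1, by omega⟩ = lam ⟨0, by omega⟩ + (β : ℂ)
  zeroSet : ∃ φ : ℂ → ℂ, IsSineType φ ∧ samplingSet β lam = {z | φ z = 0}
  frame : IsTwoUniformTightFrame ((K : ℝ) ^ 2 / (K : ℝ)) (coeffVector α)

/-- The signals `f ∈ B^p_π` with `f(nβ + λ_1) ≠ 0` for all `n ∈ ℤ`. -/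
def recoverableSignals (p : ENNReal) (β : ℝ) (lam1 : ℂ) : Set (ℂ → ℂ) :=
  {f | f ∈ BernsteinSpace p Real.pi ∧ ∀ n : ℤ, f ((n : ℂ) * (β : ℂ) + lam1) ≠ 0}

/-- The overall sampling rate: `K²` measurements in every interval of length `β`. -/
noncomputable def overallRate (K : ℕ) (β : ℝ) : ℝ := (K : ℝ) ^ 2 / β

/-- The Nyquist rate `σ / π` (samples per unit length) of signals with bandwidth `[-σ, σ]`. -/
noncomputable def nyquistRate (σ : ℝ) : ℝ := σ / Real.pi

end PhaseRetrieval

/-! ### Growth of functions of exponential type -/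

namespace PhaseRetrieval

open Complex Filter Topology Set Metric

/-! For fixed `n` the intensities are squared frame coefficients of the block `(f (nβ + λ_k))_k`.
The `K²` rank-one matrices of the frame vectors have Gram matrix `(1 - u) I + u J`, which is
invertible, so they span all matrices and the block is known up to a phase (`mul_conj_eq`).
Consecutive blocks share a node at which `f ≠ 0`, so all phases agree, and `g - c f` vanishes on the
sampling set.

That set is the zero set of a product `P` of `N ≤ K - 1` shifted sines, of growth `e^{Nπ|Im z|/β}`.
Comparing `P` with the sine-type function gives `β ≤ N` (`IsSineType.le_card`): otherwise their
quotient is zero free, hence `exp (a + b z)`, and cannot grow in both vertical directions. A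
function of `B^p_π` is bounded on the real line, so its quotient by `P`, if it vanishes where `P`
does, is bounded and hence constant; since `|P|` is `β`-periodic, membership in `L^p` forces this
constant to be zero (`eq_zero_of_vanish`).

The bound `β ≤ K - 1` also gives `K² / β ≥ K² / (K - 1) ≥ 4`, with equality for `K = 2`, `β = 1`,
the integers as sampling set and a tetrahedral frame in `ℂ²`. -/

lemma EntireOfExpType.norm_le_of_im_nonneg {σ M : ℝ} {f : ℂ → ℂ} (hf : EntireOfExpType σ f)
    (hM : ∀ x : ℝ, ‖f x‖ ≤ M) {z : ℂ} (hz : 0 ≤ z.im) :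
    ‖f z‖ ≤ M * Real.exp (σ * z.im) := by
  have key : ∀ ε : ℝ, 0 < ε → ‖f z‖ ≤ M * Real.exp ((σ + ε) * z.im) := by
    intro ε hε
    obtain ⟨C, hC⟩ := hf.2 ε hε
    have hfd := hf.1
    -- The substitution `z = I w` turns the upper half-plane into the right one. The exponential
    -- factor makes `G` bounded on the positive real axis and has modulus one on the imaginary axis,
    -- as Phragmén–Lindelöf requires.
    let G : ℂ → ℂ := fun w => f (I * w) * exp (-((σ + ε : ℝ) : ℂ) * w)
    have hG : ∀ w, ‖G w‖ = ‖f (I * w)‖ * Real.exp (-(σ + ε) * w.re) := by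
      intro w
      simp only [G, norm_mul, Complex.norm_exp, neg_mul, neg_re, re_ofReal_mul]
    have h1 : ‖G (-I * z)‖ ≤ M := by
      apply PhragmenLindelof.right_half_plane_of_bounded_on_real (f := G)
      · exact Differentiable.diffContOnCl (by fun_prop)
      · refine ⟨1, by norm_num, 2 * |σ + ε|, Asymptotics.IsBigO.of_bound C ?_⟩
        refine Eventually.of_forall fun w => ?_
        rw [hG, Real.rpow_one, Real.norm_eq_abs, Real.abs_exp]
        have h2 := hC (I * w)
        have hC0 : 0 ≤ C := nonneg_of_mul_nonneg_left ((norm_nonneg _).trans h2) (Real.exp_pos _)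
        rw [norm_mul, norm_I, one_mul] at h2
        calc _ ≤ C * Real.exp ((σ + ε) * ‖w‖) * Real.exp (-(σ + ε) * w.re) := by gcongr
          _ = C * Real.exp ((σ + ε) * ‖w‖ + -(σ + ε) * w.re) := by rw [mul_assoc, Real.exp_add]
          _ ≤ _ := by
            gcongr
            have h3 : (σ + ε) * ‖w‖ ≤ |σ + ε| * ‖w‖ := by gcongr; exact le_abs_self _
            have h4 : -(σ + ε) * w.re ≤ |σ + ε| * ‖w‖ := by
              refine (le_abs_self _).trans ?_
              rw [abs_mul, abs_neg]
              gcongr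
              exact abs_re_le_norm w
            linarith
      · refine ⟨C, ?_⟩
        rw [eventually_map]
        filter_upwards [eventually_ge_atTop 0] with x hx
        rw [hG]
        have h2 := hC (I * x)
        rw [norm_mul, norm_I, one_mul, Complex.norm_real, Real.norm_eq_abs, abs_of_nonneg hx] at h2
        calc _ ≤ C * Real.exp ((σ + ε) * x) * Real.exp (-(σ + ε) * x) := by
              simp only [ofReal_re]; gcongr
          _ = C := by rw [mul_assoc, ← Real.exp_add, ← add_mul, add_neg_cancel]; simp
      · intro x
        rw [hG]
        have : I * (x * I) = ((-x : ℝ) : ℂ) := by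
          push_cast; linear_combination (x : ℂ) * I_mul_I
        rw [this]
        simpa using hM (-x)
      · simpa using hz
    rw [hG] at h1
    have h2 : I * (-I * z) = z := by linear_combination (-z) * I_mul_I
    have h3 : (-I * z).re = z.im := by simp
    rw [h2, h3] at h1
    calc ‖f z‖ = ‖f z‖ * Real.exp (-(σ + ε) * z.im) * Real.exp ((σ + ε) * z.im) := by
          rw [mul_assoc, ← Real.exp_add, ← add_mul, neg_add_cancel]; simp
      _ ≤ _ := by gcongr
  have hlim : Tendsto (fun ε : ℝ => M * Real.exp ((σ + ε) * z.im)) (𝓝[>] 0)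
      (𝓝 (M * Real.exp (σ * z.im))) :=
    Tendsto.mono_left (Continuous.tendsto' (by fun_prop) _ _ (by simp)) nhdsWithin_le_nhds
  exact ge_of_tendsto hlim (eventually_nhdsWithin_of_forall fun ε hε => key ε hε)

lemma EntireOfExpType.comp_neg {σ : ℝ} {f : ℂ → ℂ} (hf : EntireOfExpType σ f) :
    EntireOfExpType σ (fun z => f (-z)) := by
  have := hf.1
  refine ⟨by fun_prop, fun ε hε => ?_⟩
  obtain ⟨C, hC⟩ := hf.2 ε hε
  exact ⟨C, fun z => by simpa using hC (-z)⟩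

/-- An entire function of exponential type `σ` bounded by `M` on the real line is at most
`M e^{σ |Im z|}`. -/
lemma EntireOfExpType.norm_le {σ M : ℝ} {f : ℂ → ℂ} (hf : EntireOfExpType σ f)
    (hM : ∀ x : ℝ, ‖f x‖ ≤ M) (z : ℂ) : ‖f z‖ ≤ M * Real.exp (σ * |z.im|) := by
  rcases le_total 0 z.im with h | h
  · rw [abs_of_nonneg h]
    exact hf.norm_le_of_im_nonneg hM h
  · rw [abs_of_nonpos h]
    have := hf.comp_neg.norm_le_of_im_nonneg (M := M) (fun x => by simpa using hM (-x))
      (z := -z) (by simpa using h)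
    simpa using this

lemma EntireOfExpType.comp_add {σ : ℝ} (hσ : 0 ≤ σ) {f : ℂ → ℂ} (hf : EntireOfExpType σ f) (a : ℂ) :
    EntireOfExpType σ (fun z => f (z + a)) := by
  have := hf.1
  refine ⟨by fun_prop, fun ε hε => ?_⟩
  obtain ⟨C, hC⟩ := hf.2 ε hε
  have hC0 : 0 ≤ C := nonneg_of_mul_nonneg_left ((norm_nonneg _).trans (hC 0)) (Real.exp_pos _)
  refine ⟨C * Real.exp ((σ + ε) * ‖a‖), fun z => (hC (z + a)).trans ?_⟩
  rw [mul_assoc, ← Real.exp_add, ← mul_add, add_comm ‖a‖]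
  gcongr
  exact norm_add_le z a

lemma EntireOfExpType.sub {σ : ℝ} {f g : ℂ → ℂ} (hf : EntireOfExpType σ f)
    (hg : EntireOfExpType σ g) : EntireOfExpType σ (fun z => f z - g z) := by
  refine ⟨hf.1.sub hg.1, fun ε hε => ?_⟩
  obtain ⟨C, hC⟩ := hf.2 ε hε
  obtain ⟨D, hD⟩ := hg.2 ε hε
  refine ⟨C + D, fun z => ?_⟩
  rw [add_mul]
  exact (norm_sub_le _ _).trans (add_le_add (hC z) (hD z))

lemma EntireOfExpType.const_mul {σ : ℝ} {f : ℂ → ℂ} (hf : EntireOfExpType σ f) (c : ℂ) :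
    EntireOfExpType σ (fun z => c * f z) := by
  refine ⟨hf.1.const_mul c, fun ε hε => ?_⟩
  obtain ⟨C, hC⟩ := hf.2 ε hε
  refine ⟨‖c‖ * C, fun z => ?_⟩
  rw [norm_mul, mul_assoc]
  gcongr
  exact hC z

lemma BernsteinSpace.sub_const_mul {p : ENNReal} {σ : ℝ} {f g : ℂ → ℂ}
    (hf : f ∈ BernsteinSpace p σ) (hg : g ∈ BernsteinSpace p σ) (c : ℂ) :
    (fun z => g z - c * f z) ∈ BernsteinSpace p σ :=
  ⟨hg.1.sub (hf.1.const_mul c), hg.2.sub (hf.2.const_mul c)⟩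

/-- A primitive of a function of exponential type `σ` is of exponential type `σ`. -/
lemma EntireOfExpType.of_deriv {σ : ℝ} (hσ : 0 ≤ σ) {h F : ℂ → ℂ} (hh : EntireOfExpType σ h)
    (hF : ∀ z, HasDerivAt F (h z) z) : EntireOfExpType σ F := by
  refine ⟨fun z => (hF z).differentiableAt, fun ε hε => ?_⟩
  -- The other half of `ε` absorbs the factor `‖z‖` from the mean value inequality.
  obtain ⟨C, hC⟩ := hh.2 (ε / 2) (by positivity)
  have hC0 : 0 ≤ C := nonneg_of_mul_nonneg_left ((norm_nonneg _).trans (hC 0)) (Real.exp_pos _)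
  refine ⟨‖F 0‖ + C * (2 / ε), fun z => ?_⟩
  have h1 : ‖F z - F 0‖ ≤ C * Real.exp ((σ + ε / 2) * ‖z‖) * ‖z - 0‖ := by
    refine Convex.norm_image_sub_le_of_norm_hasDerivWithin_le (s := closedBall (0 : ℂ) ‖z‖)
      (f' := h) (fun w _ => (hF w).hasDerivWithinAt) (fun w hw => (hC w).trans ?_)
      (convex_closedBall _ _) (by simp) (by simp)
    rw [mem_closedBall_zero_iff] at hw
    gcongr
  have h2 : ‖z‖ ≤ 2 / ε * Real.exp (ε / 2 * ‖z‖) := by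
    have := Real.add_one_le_exp (ε / 2 * ‖z‖)
    rw [div_mul_eq_mul_div, le_div_iff₀ hε]
    linarith
  have h3 : 1 ≤ Real.exp ((σ + ε) * ‖z‖) := Real.one_le_exp (by positivity)
  calc ‖F z‖ ≤ ‖F 0‖ + ‖F z - F 0‖ := norm_le_norm_add_norm_sub' _ _ |>.trans (by linarith)
    _ ≤ ‖F 0‖ + C * Real.exp ((σ + ε / 2) * ‖z‖) * (2 / ε * Real.exp (ε / 2 * ‖z‖)) := by
        rw [sub_zero] at h1
        gcongr
        exact h1.trans (by gcongr)
    _ = ‖F 0‖ + C * (2 / ε) * Real.exp ((σ + ε) * ‖z‖) := by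
        have : (σ + ε) * ‖z‖ = (σ + ε / 2) * ‖z‖ + ε / 2 * ‖z‖ := by ring
        rw [this, Real.exp_add]; ring
    _ ≤ _ := by
        rw [add_mul ‖F 0‖]
        gcongr
        exact le_mul_of_one_le_right (norm_nonneg _) h3

/-- The pointwise bound `|k| ≤ 1 + |k|^p` takes the place of Hölder's inequality. -/
lemma exists_integral_norm_le_of_memLp {p : ENNReal} (hp : 1 ≤ p) (hp' : p < ⊤) {k : ℝ → ℂ}
    (hk : Continuous k) (hk' : MeasureTheory.MemLp k p MeasureTheory.volume) :
    ∃ M : ℝ, ∀ x : ℝ, ∫ t in x..x + 1, ‖k t‖ ≤ M := by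
  have hp0 : p ≠ 0 := (zero_lt_one.trans_le hp).ne'
  have hint := hk'.integrable_norm_rpow hp0 hp'.ne
  have hpr : 1 ≤ p.toReal := by
    rw [← ENNReal.toReal_one]
    exact ENNReal.toReal_mono hp'.ne hp
  refine ⟨1 + ∫ t, ‖k t‖ ^ p.toReal, fun x => ?_⟩
  have hc : Continuous fun t => ‖k t‖ ^ p.toReal :=
    hk.norm.rpow_const fun _ => Or.inr (by positivity)
  calc ∫ t in x..x + 1, ‖k t‖ ≤ ∫ t in x..x + 1, (1 + ‖k t‖ ^ p.toReal) := by
        refine intervalIntegral.integral_mono_on (by linarith) (hk.norm.intervalIntegrable _ _)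
          ((continuous_const.add hc).intervalIntegrable _ _) fun t _ => ?_
        rcases le_total ‖k t‖ 1 with h | h
        · have : 0 ≤ ‖k t‖ ^ p.toReal := by positivity
          linarith
        · have := Real.self_le_rpow_of_one_le h hpr
          linarith
    _ = 1 + ∫ t in x..x + 1, ‖k t‖ ^ p.toReal := by
        rw [intervalIntegral.integral_add (by simp) (hc.intervalIntegrable _ _)]
        simp
    _ ≤ _ := by
        gcongr
        rw [intervalIntegral.integral_of_le (by linarith)]
        exact MeasureTheory.setIntegral_le_integral hint
          (Eventually.of_forall fun t => by positivity)

/-- Functions in the Bernstein space `B^p_σ` are bounded on the real line. -/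
lemma BernsteinSpace.bounded {p : ENNReal} (hp : 1 ≤ p) (hp' : p < ⊤) {σ : ℝ} (hσ : 0 ≤ σ)
    {h : ℂ → ℂ} (hh : h ∈ BernsteinSpace p σ) : ∃ M : ℝ, ∀ x : ℝ, ‖h x‖ ≤ M := by
  obtain ⟨hE, hL⟩ := hh
  have hcont : Continuous fun t : ℝ => h t := hE.1.continuous.comp continuous_ofReal
  obtain ⟨M, hM⟩ := exists_integral_norm_le_of_memLp hp hp' hcont hL
  -- Increments of the primitive `F` over steps `s ≤ 1` are bounded on the real line, hence on
  -- horizontal strips. Cauchy's estimate then bounds their derivative `h (x + s) - h x`, and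
  -- averaging over `[x, x + 1]` bounds `h x`.
  obtain ⟨F, hF⟩ := hE.1.isExactOn_univ
  replace hF : ∀ z, HasDerivAt F (h z) z := fun z => hF z (mem_univ z)
  have hFE := hE.of_deriv hσ hF
  have hdiff : ∀ s ∈ Icc (0 : ℝ) 1, ∀ x : ℝ, ‖h (x + s) - h x‖ ≤ M * Real.exp σ := by
    intro s hs x
    have hb : ∀ x : ℝ, ‖F (x + s) - F x‖ ≤ M := by
      intro x
      have h1 : ∫ t in x..x + s, h t = F (x + s) - F x := by
        have := intervalIntegral.integral_eq_sub_of_hasDerivAt (a := x) (b := x + s)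
          (f := fun t : ℝ => F t) (f' := fun t : ℝ => h t) (fun t _ => (hF t).comp_ofReal)
          (hcont.intervalIntegrable _ _)
        simpa using this
      rw [← h1]
      refine (intervalIntegral.norm_integral_le_integral_norm (by linarith [hs.1])).trans
        (le_trans ?_ (hM x))
      exact intervalIntegral.integral_mono_interval le_rfl (by linarith [hs.1])
        (by linarith [hs.2]) (Eventually.of_forall fun _ => norm_nonneg _)
        (hcont.norm.intervalIntegrable _ _)
    have hM0 : 0 ≤ M := (norm_nonneg _).trans (hb 0)
    have hE' := (hFE.comp_add hσ s).sub hFE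
    have h2 := hE'.norm_le hb
    have h3 : HasDerivAt (fun z => F (z + s) - F z) (h (x + s) - h x) x :=
      ((hF (x + s)).comp_add_const (x : ℂ) (s : ℂ)).sub (hF x)
    rw [← h3.deriv]
    have h4 := norm_deriv_le_of_forall_mem_sphere_norm_le (c := (x : ℂ)) (C := M * Real.exp σ)
      one_pos hE'.1.diffContOnCl fun z hz => (h2 z).trans ?_
    · simpa using h4
    · have : |z.im| ≤ 1 := by
        have h5 := abs_im_le_norm (z - x)
        rw [mem_sphere_iff_norm.1 hz] at h5
        simpa using h5
      gcongr
      nlinarith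
  refine ⟨M * Real.exp σ + M, fun x => ?_⟩
  have h1 : ∫ t in x..x + 1, ‖h x‖ ≤ ∫ t in x..x + 1, (M * Real.exp σ + ‖h t‖) := by
    refine intervalIntegral.integral_mono_on (by linarith) (by simp)
      ((continuous_const.add hcont.norm).intervalIntegrable _ _) fun t ht => ?_
    have h2 := hdiff (t - x) ⟨by linarith [ht.1], by linarith [ht.2]⟩ x
    have h3 : ((x : ℂ) + (t - x : ℝ)) = t := by push_cast; ring
    rw [h3] at h2
    have := norm_le_norm_add_norm_sub' (h x) (h t)
    rw [norm_sub_rev] at this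
    linarith
  rw [intervalIntegral.integral_add (by simp) (hcont.norm.intervalIntegrable _ _)] at h1
  simp only [intervalIntegral.integral_const, add_sub_cancel_left, one_smul] at h1
  linarith [hM x]

/-! ### Products of shifted sines -/

/-- The product of the shifted sines `sin (π (z - s) / β)` over `s ∈ S`. -/
noncomputable def sinProd (β : ℝ) (S : Finset ℂ) (z : ℂ) : ℂ :=
  ∏ s ∈ S, sin (Real.pi * (z - s) / β)

lemma differentiable_sinProd (β : ℝ) (S : Finset ℂ) : Differentiable ℂ (sinProd β S) := by
  unfold sinProd
  fun_prop

lemma sin_shift_eq_zero_iff {β : ℝ} (hβ : 0 < β) (s z : ℂ) :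
    sin (Real.pi * (z - s) / β) = 0 ↔ ∃ n : ℤ, z = n * β + s := by
  have hπ : (Real.pi : ℂ) ≠ 0 := ofReal_ne_zero.2 Real.pi_ne_zero
  have hβ' : (β : ℂ) ≠ 0 := ofReal_ne_zero.2 hβ.ne'
  rw [Complex.sin_eq_zero_iff]
  refine exists_congr fun n => ?_
  rw [div_eq_iff hβ']
  constructor
  · intro h
    have : (Real.pi : ℂ) * (z - s) = Real.pi * (n * β) := by rw [h]; ring
    linear_combination mul_left_cancel₀ hπ this
  · rintro rfl
    ring

lemma sinProd_eq_zero_iff {β : ℝ} (hβ : 0 < β) {S : Finset ℂ} {z : ℂ} :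
    sinProd β S z = 0 ↔ ∃ s ∈ S, ∃ n : ℤ, z = n * β + s := by
  simp only [sinProd, Finset.prod_eq_zero_iff, sin_shift_eq_zero_iff hβ]

/-- The zeros of a product of sines are simple if the shifts are incongruent modulo `β`. -/
lemma deriv_sinProd_ne_zero {β : ℝ} (hβ : 0 < β) {S : Finset ℂ}
    (hS : ∀ s ∈ S, ∀ t ∈ S, ∀ n : ℤ, s = n * β + t → s = t) {z : ℂ} (hz : sinProd β S z = 0) :
    deriv (sinProd β S) z ≠ 0 := by
  classical
  obtain ⟨s, hs, hsz⟩ := (sinProd_eq_zero_iff hβ).1 hz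
  have hsz0 := (sin_shift_eq_zero_iff hβ s z).2 hsz
  have hfun : sinProd β S = fun w => sin (Real.pi * (w - s) / β) * sinProd β (S.erase s) w := by
    funext w
    exact (Finset.mul_prod_erase S _ hs).symm
  have hne : sinProd β (S.erase s) z ≠ 0 := by
    intro h
    obtain ⟨t, ht, m, hm⟩ := (sinProd_eq_zero_iff hβ).1 h
    obtain ⟨n, hn⟩ := hsz
    refine Finset.ne_of_mem_erase ht (hS t (Finset.mem_of_mem_erase ht) s hs (n - m) ?_)
    push_cast
    linear_combination hn - hm
  have hβ' : (β : ℂ) ≠ 0 := ofReal_ne_zero.2 hβ.ne'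
  have hπ : (Real.pi : ℂ) ≠ 0 := ofReal_ne_zero.2 Real.pi_ne_zero
  have hd : HasDerivAt (fun w : ℂ => sin (Real.pi * (w - s) / β))
      (cos (Real.pi * (z - s) / β) * (Real.pi / β)) z := by
    have : HasDerivAt (fun w : ℂ => Real.pi * (w - s) / β) (Real.pi / β : ℂ) z := by
      simpa using (((hasDerivAt_id z).sub_const s).const_mul (Real.pi : ℂ)).div_const (β : ℂ)
    exact this.csin
  rw [hfun, (hd.fun_mul (differentiable_sinProd β _ z).hasDerivAt).deriv, hsz0, zero_mul, add_zero]
  refine mul_ne_zero (mul_ne_zero (fun hc => ?_) (div_ne_zero hπ hβ')) hne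
  have := Complex.sin_sq_add_cos_sq (Real.pi * (z - s) / β)
  rw [hc, hsz0] at this
  simp at this

/-- Each sine changes at most its sign. This transports lower bounds between vertical lines and
later makes `|h|` periodic. -/
lemma norm_sinProd_add_zsmul {β : ℝ} (hβ : 0 < β) (S : Finset ℂ) (z : ℂ) (n : ℤ) :
    ‖sinProd β S (z + n * β)‖ = ‖sinProd β S z‖ := by
  have hβ' : (β : ℂ) ≠ 0 := ofReal_ne_zero.2 hβ.ne'
  simp only [sinProd, norm_prod]
  refine Finset.prod_congr rfl fun s _ => ?_
  have : (Real.pi * (z + n * β - s) / β : ℂ) = Real.pi * (z - s) / β + n * Real.pi := by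
    field_simp
    ring
  have hcos : ‖cos (n * Real.pi : ℂ)‖ = 1 := by
    have h := Real.abs_cos_int_mul_pi n
    rw [← Real.norm_eq_abs, ← Complex.norm_real] at h
    push_cast at h
    exact h
  rw [this, Complex.sin_add, Complex.sin_int_mul_pi, mul_zero, add_zero, norm_mul, hcos, mul_one]

lemma norm_sin_le_exp_abs_im (w : ℂ) : ‖sin w‖ ≤ Real.exp |w.im| := by
  have h : sin w = (exp (-w * I) - exp (w * I)) * I / 2 := rfl
  have h1 : ‖exp (-w * I)‖ ≤ Real.exp |w.im| := by
    rw [Complex.norm_exp]; gcongr; simpa using le_abs_self w.im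
  have h2 : ‖exp (w * I)‖ ≤ Real.exp |w.im| := by
    rw [Complex.norm_exp]; gcongr; simpa using neg_le_abs w.im
  have h3 := norm_sub_le (exp (-w * I)) (exp (w * I))
  rw [h, norm_div, norm_mul, norm_I]
  simp only [mul_one, Complex.norm_ofNat]
  linarith

lemma exp_abs_im_le_norm_sin {w : ℂ} (hw : 1 ≤ |w.im|) : Real.exp |w.im| / 4 ≤ ‖sin w‖ := by
  have h : sin w = (exp (-w * I) - exp (w * I)) * I / 2 := rfl
  have h1 : ‖exp (-w * I)‖ = Real.exp w.im := by rw [Complex.norm_exp]; simp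
  have h2 : ‖exp (w * I)‖ = Real.exp (-w.im) := by rw [Complex.norm_exp]; simp
  have h3 := abs_norm_sub_norm_le (exp (-w * I)) (exp (w * I))
  -- With `E = exp |w.im| ≥ 2`, `(E - 1) / 2 ≥ E / 4`.
  have h4 : 2 ≤ Real.exp |w.im| := by
    have := Real.add_one_le_exp |w.im|
    linarith
  have h5 : Real.exp (-|w.im|) ≤ 1 := Real.exp_le_one_iff.2 (by simp)
  have h6 : Real.exp |w.im| - Real.exp (-|w.im|) ≤ |Real.exp w.im - Real.exp (-w.im)| := by
    rcases abs_cases w.im with ⟨h, _⟩ | ⟨h, _⟩ <;> rw [h]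
    · exact le_abs_self _
    · rw [neg_neg, abs_sub_comm]; exact le_abs_self _
  rw [h, norm_div, norm_mul, norm_I]
  rw [h1, h2] at h3
  simp only [mul_one, Complex.norm_ofNat]
  linarith

lemma im_shift (β : ℝ) (z s : ℂ) :
    (Real.pi * (z - s) / β : ℂ).im = Real.pi / β * (z.im - s.im) := by
  have : (Real.pi * (z - s) / β : ℂ) = ((Real.pi / β : ℝ) : ℂ) * (z - s) := by push_cast; ring
  rw [this, im_ofReal_mul, sub_im]

lemma exists_norm_sinProd_le {β : ℝ} (hβ : 0 < β) (S : Finset ℂ) :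
    ∃ b : ℝ, 0 < b ∧ ∀ z : ℂ,
      ‖sinProd β S z‖ ≤ b * Real.exp (S.card * (Real.pi / β) * |z.im|) := by
  classical
  have hπβ : 0 < Real.pi / β := div_pos Real.pi_pos hβ
  induction S using Finset.induction_on with
  | empty => exact ⟨1, one_pos, fun z => by simp [sinProd]⟩
  | insert s S hs ih =>
    obtain ⟨b, hb, h⟩ := ih
    refine ⟨Real.exp (Real.pi / β * |s.im|) * b, by positivity, fun z => ?_⟩
    have h1 : ‖sin (Real.pi * (z - s) / β)‖ ≤
        Real.exp (Real.pi / β * |s.im|) * Real.exp (Real.pi / β * |z.im|) := by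
      refine (norm_sin_le_exp_abs_im _).trans ?_
      rw [im_shift, abs_mul, abs_of_pos hπβ, ← Real.exp_add, ← mul_add, add_comm |s.im|]
      gcongr
      exact abs_sub _ _
    have h2 : sinProd β (insert s S) z = sin (Real.pi * (z - s) / β) * sinProd β S z :=
      Finset.prod_insert hs
    rw [h2, norm_mul, Finset.card_insert_of_notMem hs]
    calc _ ≤ Real.exp (Real.pi / β * |s.im|) * Real.exp (Real.pi / β * |z.im|) *
          (b * Real.exp (S.card * (Real.pi / β) * |z.im|)) := by gcongr; exact h z
      _ = Real.exp (Real.pi / β * |s.im|) * b *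
          (Real.exp (Real.pi / β * |z.im|) * Real.exp (S.card * (Real.pi / β) * |z.im|)) := by
        ring
      _ = _ := by rw [← Real.exp_add]; push_cast; ring_nf

lemma exists_le_norm_sinProd {β : ℝ} (hβ : 0 < β) (S : Finset ℂ) :
    ∃ a H : ℝ, 0 < a ∧ 0 < H ∧ ∀ z : ℂ, H ≤ |z.im| →
      a * Real.exp (S.card * (Real.pi / β) * |z.im|) ≤ ‖sinProd β S z‖ := by
  classical
  have hπβ : 0 < Real.pi / β := div_pos Real.pi_pos hβ
  induction S using Finset.induction_on with
  | empty => exact ⟨1, 1, one_pos, one_pos, fun z _ => by simp [sinProd]⟩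
  | insert s S hs ih =>
    obtain ⟨a, H, ha, hH, h⟩ := ih
    -- The new threshold puts the argument of the added sine at distance at least 1 from the real
    -- axis.
    refine ⟨Real.exp (-(Real.pi / β * |s.im|)) / 4 * a, max H (|s.im| + β / Real.pi),
      by positivity, by positivity, fun z hz => ?_⟩
    have hz2 : |s.im| + β / Real.pi ≤ |z.im| := (le_max_right _ _).trans hz
    have habs : |z.im| - |s.im| ≤ |z.im - s.im| := abs_sub_abs_le_abs_sub _ _
    have h1 : Real.exp (-(Real.pi / β * |s.im|)) / 4 * Real.exp (Real.pi / β * |z.im|) ≤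
        ‖sin (Real.pi * (z - s) / β)‖ := by
      refine le_trans ?_ (exp_abs_im_le_norm_sin ?_)
      · rw [im_shift, abs_mul, abs_of_pos hπβ, div_mul_eq_mul_div, ← Real.exp_add]
        gcongr
        have := mul_le_mul_of_nonneg_left habs hπβ.le
        linarith
      · rw [im_shift, abs_mul, abs_of_pos hπβ]
        calc (1 : ℝ) = Real.pi / β * (β / Real.pi) := by
              field_simp
          _ ≤ _ := by gcongr; linarith
    have h2 : sinProd β (insert s S) z = sin (Real.pi * (z - s) / β) * sinProd β S z :=
      Finset.prod_insert hs
    rw [h2, norm_mul, Finset.card_insert_of_notMem hs]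
    calc _ = Real.exp (-(Real.pi / β * |s.im|)) / 4 * Real.exp (Real.pi / β * |z.im|) *
          (a * Real.exp (S.card * (Real.pi / β) * |z.im|)) := by
            have : ((S.card + 1 : ℕ) : ℝ) * (Real.pi / β) * |z.im| =
              Real.pi / β * |z.im| + S.card * (Real.pi / β) * |z.im| := by push_cast; ring
            rw [this, Real.exp_add]; ring
      _ ≤ _ := by gcongr; exact h z ((le_max_left _ _).trans hz)

/-- There is a vertical line without zeros of `sinProd β S`. -/
lemma exists_re_sinProd_ne_zero {β : ℝ} (hβ : 0 < β) (S : Finset ℂ) :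
    ∃ x : ℝ, ∀ z : ℂ, z.re = x → sinProd β S z ≠ 0 := by
  have hc : (re '' {z : ℂ | sinProd β S z = 0}).Countable := by
    refine Countable.image ?_ _
    have : {z : ℂ | sinProd β S z = 0} = ⋃ s ∈ S, range fun n : ℤ => (n * β + s : ℂ) := by
      ext z
      simp only [mem_ofPred_eq, sinProd_eq_zero_iff hβ, mem_iUnion, mem_range, exists_prop, eq_comm]
    rw [this]
    exact S.countable_toSet.biUnion fun s _ => countable_range _
  obtain ⟨x, hx⟩ : ∃ x, x ∉ re '' {z : ℂ | sinProd β S z = 0} := by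
    by_contra! h
    exact not_countable_univ (α := ℝ) (hc.mono fun x _ => h x)
  exact ⟨x, fun z hz h0 => hx ⟨z, h0, hz⟩⟩

/-! ### Division by products of sines -/

/-- Division of an entire function by an entire function with simple zeros. -/
lemma exists_eq_mul_of_simple_zeros {f g : ℂ → ℂ} (hf : Differentiable ℂ f)
    (hg : Differentiable ℂ g) (hg' : ∀ z, g z = 0 → deriv g z ≠ 0)
    (hfg : ∀ z, g z = 0 → f z = 0) :
    ∃ u : ℂ → ℂ, Differentiable ℂ u ∧ ∀ z, f z = u z * g z := by
  classical
  -- The value at a zero is l'Hôpital's; near a zero the quotient is that of the two difference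
  -- quotients `dslope`.
  refine ⟨fun z => if g z = 0 then deriv f z / deriv g z else f z / g z, fun z => ?_, fun z => ?_⟩
  · by_cases hz : g z = 0
    · have hdd : ∀ k : ℂ → ℂ, Differentiable ℂ k → Differentiable ℂ (dslope k z) := by
        intro k hk
        rw [← differentiableOn_univ] at hk ⊢
        exact (Complex.differentiableOn_dslope univ_mem).2 hk
      have h0 : dslope g z z ≠ 0 := by rw [dslope_same]; exact hg' z hz
      have hev : ∀ᶠ w in 𝓝 z, dslope g z w ≠ 0 := (hdd g hg z).continuousAt.eventually_ne h0
      refine (((hdd f hf) z).div ((hdd g hg) z) h0).congr_of_eventuallyEq ?_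
      filter_upwards [hev] with w hw
      have e : ∀ k : ℂ → ℂ, k z = 0 → k w = (w - z) * dslope k z w := fun k hk => by
        have := sub_smul_dslope k z w
        rw [hk, sub_zero, smul_eq_mul] at this
        exact this.symm
      rcases eq_or_ne w z with rfl | hne
      · simp [hz, dslope_same]
      · have hw0 : w - z ≠ 0 := sub_ne_zero.2 hne
        rw [e g hz, e f (hfg z hz), if_neg (mul_ne_zero hw0 hw), Pi.div_apply,
          mul_div_mul_left _ _ hw0]
    · have hev : ∀ᶠ w in 𝓝 z, g w ≠ 0 := (hg z).continuousAt.eventually_ne hz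
      refine ((hf z).div (hg z) hz).congr_of_eventuallyEq ?_
      filter_upwards [hev] with w hw
      simp [hw]
  · by_cases hz : g z = 0
    · simp [hz, hfg z hz]
    · simp [hz]

/-- The quotient of an entire function of growth `e^{σ |Im z|}` by a product of sines. -/
lemma exists_eq_mul_sinProd {β : ℝ} (hβ : 0 < β) {S : Finset ℂ}
    (hS : ∀ s ∈ S, ∀ t ∈ S, ∀ n : ℤ, s = n * β + t → s = t) {σ M : ℝ} {f : ℂ → ℂ}
    (hf : Differentiable ℂ f) (hM : ∀ z, ‖f z‖ ≤ M * Real.exp (σ * |z.im|))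
    (hz : ∀ z, sinProd β S z = 0 → f z = 0) :
    ∃ (u : ℂ → ℂ) (C : ℝ), Differentiable ℂ u ∧ (∀ z, f z = u z * sinProd β S z) ∧ 0 < C ∧
      ∀ z, ‖u z‖ ≤ C * Real.exp ((σ - S.card * (Real.pi / β)) * |z.im|) := by
  obtain ⟨u, hu, hfu⟩ := exists_eq_mul_of_simple_zeros hf (differentiable_sinProd β S)
    (fun z => deriv_sinProd_ne_zero hβ hS) hz
  obtain ⟨a, H, ha, hH, hlow⟩ := exists_le_norm_sinProd hβ S
  obtain ⟨x₀, hx₀⟩ := exists_re_sinProd_ne_zero hβ S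
  set ρ := σ - S.card * (Real.pi / β) with hρ
  have hM0 : 0 ≤ M := nonneg_of_mul_nonneg_left ((norm_nonneg _).trans (hM 0)) (Real.exp_pos _)
  have hout : ∀ z : ℂ, H ≤ |z.im| → ‖u z‖ ≤ M / a * Real.exp (ρ * |z.im|) := by
    intro z hz
    have h1 := hlow z hz
    have h2 := hM z
    rw [hfu, norm_mul] at h2
    have h3 : ‖u z‖ * (a * Real.exp (S.card * (Real.pi / β) * |z.im|)) ≤
        M * Real.exp (σ * |z.im|) := le_trans (by gcongr) h2
    have h4 : σ * |z.im| = ρ * |z.im| + S.card * (Real.pi / β) * |z.im| := by rw [hρ]; ring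
    rw [h4, Real.exp_add, ← mul_assoc, ← mul_assoc] at h3
    have h5 := le_of_mul_le_mul_right h3 (Real.exp_pos _)
    rw [div_mul_eq_mul_div, le_div_iff₀ ha]
    exact h5
  -- Inside the strip `|Im z| ≤ H` the maximum principle is applied on rectangles of width `β`.
  -- Their vertical sides are translates of a zero-free segment, so one lower bound for the sine
  -- product serves for all of them.
  obtain ⟨c, hc, hseg⟩ : ∃ c : ℝ, 0 < c ∧ ∀ y ∈ Icc (-H) H, c ≤ ‖sinProd β S (x₀ + y * I)‖ := by
    have hcont : ContinuousOn (fun y : ℝ => ‖sinProd β S (x₀ + y * I)‖) (Icc (-H) H) := by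
      have := (differentiable_sinProd β S).continuous
      fun_prop
    obtain ⟨y₀, _, hy⟩ := isCompact_Icc.exists_isMinOn (nonempty_Icc.2 (by linarith)) hcont
    refine ⟨_, norm_pos_iff.2 (hx₀ (x₀ + y₀ * I) (by simp)), fun y hy' => hy hy'⟩
  set M₁ := max (M * Real.exp (|σ| * H) / c) (M / a * Real.exp (ρ * H)) with hM₁
  have hM₁0 : 0 ≤ M₁ := le_max_of_le_left (by positivity)
  have hvert : ∀ (n : ℤ) (y : ℝ), y ∈ Icc (-H) H → ∀ z : ℂ, z.re = x₀ + n * β → z.im = y →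
      ‖u z‖ ≤ M₁ := by
    intro n y hy z hre him
    have hz : z = (x₀ + y * I) + n * β := by
      apply Complex.ext <;> simp [hre, him]
    have h1 : c ≤ ‖sinProd β S z‖ := by rw [hz, norm_sinProd_add_zsmul hβ]; exact hseg y hy
    have h2 := hM z
    have h3 : σ * |z.im| ≤ |σ| * H := by
      rw [him]
      exact mul_le_mul (le_abs_self _) (abs_le.2 hy) (abs_nonneg _) (abs_nonneg _)
    refine le_max_of_le_left ?_
    rw [le_div_iff₀ hc]
    calc ‖u z‖ * c ≤ ‖u z‖ * ‖sinProd β S z‖ := by gcongr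
      _ = ‖f z‖ := by rw [hfu, norm_mul]
      _ ≤ M * Real.exp (σ * |z.im|) := h2
      _ ≤ _ := by gcongr
  have hin : ∀ z : ℂ, |z.im| ≤ H → ‖u z‖ ≤ M₁ := by
    intro z hz
    set n : ℤ := ⌊(z.re - x₀) / β⌋ with hn
    have hn1 : x₀ + n * β ≤ z.re := by
      have := Int.floor_le ((z.re - x₀) / β)
      rw [le_div_iff₀ hβ] at this
      linarith
    have hn2 : z.re ≤ x₀ + (n + 1 : ℤ) * β := by
      have := (Int.lt_floor_add_one ((z.re - x₀) / β)).le
      rw [div_le_iff₀ hβ] at this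
      push_cast
      linarith
    have hlt : x₀ + n * β < x₀ + (n + 1 : ℤ) * β := by push_cast; linarith
    set U : Set ℂ := Ioo (x₀ + n * β) (x₀ + (n + 1 : ℤ) * β) ×ℂ Ioo (-H) H with hU
    have hcl : closure U = Icc (x₀ + n * β) (x₀ + (n + 1 : ℤ) * β) ×ℂ Icc (-H) H := by
      rw [hU, Complex.closure_reProdIm, closure_Ioo hlt.ne, closure_Ioo (by linarith)]
    have hopen : IsOpen U := isOpen_Ioo.reProdIm isOpen_Ioo
    refine norm_le_of_forall_mem_frontier_norm_le (U := U)
      (((isBounded_Ioo _ _).reProdIm (isBounded_Ioo _ _))) hu.diffContOnCl ?_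
      (hcl ▸ ⟨⟨hn1, hn2⟩, abs_le.1 hz⟩)
    intro w hw
    rw [hopen.frontier_eq, hcl] at hw
    obtain ⟨⟨hwre, hwim⟩, hwn⟩ := hw
    simp only [mem_preimage] at hwre hwim
    by_cases h1 : H ≤ |w.im|
    · have h2 : |w.im| = H := le_antisymm (abs_le.2 hwim) h1
      refine le_max_of_le_right ?_
      have := hout w h1
      rwa [h2] at this
    · rw [not_le, abs_lt] at h1
      rcases hwre.1.eq_or_lt with h2 | h2
      · exact hvert n w.im hwim w h2.symm rfl
      rcases hwre.2.eq_or_lt with h3 | h3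
      · exact hvert (n + 1) w.im hwim w h3 rfl
      · exact absurd ⟨⟨h2, h3⟩, h1⟩ hwn
  -- The factor `exp (|ρ| H)` allows for negative `ρ`; the summand 1 makes the constant positive.
  refine ⟨u, M / a + M₁ * Real.exp (|ρ| * H) + 1, hu, hfu, by positivity, fun z => ?_⟩
  rcases le_total H |z.im| with h | h
  · refine (hout z h).trans ?_
    gcongr
    have : 0 ≤ M₁ * Real.exp (|ρ| * H) := by positivity
    linarith
  · have h1 : 1 ≤ Real.exp (|ρ| * H) * Real.exp (ρ * |z.im|) := by
      rw [← Real.exp_add]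
      apply Real.one_le_exp
      have h2 : -(ρ * |z.im|) ≤ |ρ| * H := by
        rw [← neg_mul]
        exact mul_le_mul (neg_le_abs ρ) h (abs_nonneg _) (abs_nonneg _)
      linarith
    calc ‖u z‖ ≤ M₁ := hin z h
      _ ≤ M₁ * (Real.exp (|ρ| * H) * Real.exp (ρ * |z.im|)) := le_mul_of_one_le_right hM₁0 h1
      _ = M₁ * Real.exp (|ρ| * H) * Real.exp (ρ * |z.im|) := by ring
      _ ≤ _ := by
        gcongr
        have : 0 ≤ M / a := by positivity
        linarith

/-! ### Zero-free quotients and the density of zeros -/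

/-- A zero free entire function of growth `e^{δ |Im z|}` is the exponential of an affine
function. -/
lemma exists_eq_exp_affine {ψ : ℂ → ℂ} (hψ : Differentiable ℂ ψ) (hψ0 : ∀ z, ψ z ≠ 0) {C δ : ℝ}
    (hδ : 0 ≤ δ) (hC : 0 < C) (hb : ∀ z, ‖ψ z‖ ≤ C * Real.exp (δ * |z.im|)) :
    ∃ a b : ℂ, ∀ z, ψ z = exp (a + b * z) := by
  have hdψ : Differentiable ℂ (deriv ψ) := by
    rw [← differentiableOn_univ] at hψ ⊢
    exact hψ.deriv isOpen_univ
  have hq : Differentiable ℂ fun z => deriv ψ z / ψ z := fun z =>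
    (hdψ z).div (hψ z) (hψ0 z)
  obtain ⟨G₀, hG₀⟩ := hq.isExactOn_univ
  obtain ⟨G, hG, hψG⟩ : ∃ G : ℂ → ℂ, Differentiable ℂ G ∧ ∀ z, ψ z = exp (G z) := by
    have hd : ∀ z, HasDerivAt (fun w => ψ w * exp (-G₀ w)) 0 z := by
      intro z
      have h1 := (hψ z).hasDerivAt.fun_mul (hG₀ z (mem_univ z)).fun_neg.cexp
      refine h1.congr_deriv ?_
      have h2 : ψ z * (deriv ψ z / ψ z) = deriv ψ z := mul_div_cancel₀ _ (hψ0 z)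
      linear_combination -exp (-G₀ z) * h2
    have hconst : ∀ z, ψ z * exp (-G₀ z) = ψ 0 * exp (-G₀ 0) := fun z =>
      is_const_of_deriv_eq_zero (fun w => (hd w).differentiableAt) (fun w => (hd w).deriv) z 0
    refine ⟨fun z => G₀ z + log (ψ 0 * exp (-G₀ 0)), ?_, fun z => ?_⟩
    · exact fun z => (hG₀ z (mem_univ z)).differentiableAt.add_const _
    · rw [exp_add, exp_log (mul_ne_zero (hψ0 0) (exp_ne_zero _)), ← hconst z, exp_neg]
      field_simp
  have hre : ∀ z, (G z).re ≤ |Real.log C| + 1 + δ * ‖z‖ := by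
    intro z
    have h1 := hb z
    rw [hψG, Complex.norm_exp, ← Real.exp_log hC, ← Real.exp_add, Real.exp_le_exp] at h1
    have h2 : δ * |z.im| ≤ δ * ‖z‖ := by gcongr; exact abs_im_le_norm z
    linarith [le_abs_self (Real.log C)]
  set K := |Real.log C| + 1 with hK
  have hK0 : 0 < K := by positivity
  -- Borel–Carathéodory on the disc of radius `2R` turns the one-sided bound on `Re G` into linear
  -- growth of `G`. Then `G'` is bounded by Cauchy's estimate and constant by Liouville.
  have hlin : ∀ (R : ℝ) (z : ℂ), 0 < R → ‖z‖ ≤ R → ‖G z‖ ≤ 2 * (K + δ * (2 * R)) + 3 * ‖G 0‖ := by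
    intro R z hR hz
    have h1 := Complex.borelCaratheodory (f := G) (M := K + δ * (2 * R)) (R := 2 * R) (z := z)
      (by positivity) hG.differentiableOn (fun w hw => ?_) (by positivity)
      (by rw [mem_ball_zero_iff]; linarith)
    · have h2 : 0 < 2 * R - ‖z‖ := by linarith
      refine h1.trans (add_le_add ?_ ?_)
      · rw [div_le_iff₀ h2]
        gcongr
        linarith
      · rw [div_le_iff₀ h2]
        nlinarith [norm_nonneg (G 0)]
    · rw [mem_ball_zero_iff] at hw
      refine (hre w).trans ?_
      gcongr
  have hder : ∀ z, ‖deriv G z‖ ≤ 2 * K + 8 * δ + 3 * ‖G 0‖ := by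
    intro z
    have hR : 0 < ‖z‖ + 1 := by positivity
    have h1 := norm_deriv_le_of_forall_mem_sphere_norm_le (c := z)
      (C := 2 * (K + δ * (2 * (2 * (‖z‖ + 1)))) + 3 * ‖G 0‖) hR hG.diffContOnCl fun w hw => ?_
    · refine h1.trans ?_
      rw [div_le_iff₀ hR]
      nlinarith [norm_nonneg (G 0), norm_nonneg z, mul_nonneg (norm_nonneg (G 0)) (norm_nonneg z),
        mul_nonneg hK0.le (norm_nonneg z)]
    · refine hlin _ w (by positivity) ?_
      have h2 := mem_sphere_iff_norm.1 hw
      have := norm_le_norm_add_norm_sub' w z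
      linarith
  have hdG : Differentiable ℂ (deriv G) := by
    rw [← differentiableOn_univ] at hG ⊢
    exact hG.deriv isOpen_univ
  have hdc : ∀ z, deriv G z = deriv G 0 := fun z =>
    hdG.apply_eq_apply_of_bounded (isBounded_iff_forall_norm_le.2 ⟨_, by
      rintro _ ⟨w, rfl⟩; exact hder w⟩) z 0
  have haff : ∀ z, HasDerivAt (fun w => G w - deriv G 0 * w) 0 z := by
    intro z
    have h1 := (hG z).hasDerivAt.fun_sub ((hasDerivAt_id z).const_mul (deriv G 0))
    simpa [hdc z] using h1
  refine ⟨G 0, deriv G 0, fun z => ?_⟩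
  have h1 := is_const_of_deriv_eq_zero (fun w => (haff w).differentiableAt)
    (fun w => (haff w).deriv) z 0
  rw [hψG]
  congr 1
  simp only [mul_zero, sub_zero] at h1
  linear_combination h1

/-- The type of a sine-type function is at most the density of its zeros. -/
lemma IsSineType.le_card {φ : ℂ → ℂ} (hφ : IsSineType φ) {β : ℝ} (hβ : 0 < β) {S : Finset ℂ}
    (hS : ∀ s ∈ S, ∀ t ∈ S, ∀ n : ℤ, s = n * β + t → s = t)
    (hz : ∀ z, φ z = 0 ↔ sinProd β S z = 0) : β ≤ S.card := by
  by_contra! hlt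
  obtain ⟨A, B, H, hA, hB, hH, hgr⟩ := hφ.growth
  -- The growth condition says nothing inside the strip, so the bound on the line `Im z = H` is
  -- propagated to the whole plane.
  have hE := hφ.expType.comp_add Real.pi_pos.le (H * I)
  have hbd : ∀ x : ℝ, ‖φ (x + H * I)‖ ≤ B * Real.exp (Real.pi * H) := by
    intro x
    have h := (hgr (x + H * I) (by simp [abs_of_pos hH])).2
    simpa [abs_of_pos hH] using h
  have hφM : ∀ z, ‖φ z‖ ≤
      B * Real.exp (Real.pi * H) * Real.exp (Real.pi * H) * Real.exp (Real.pi * |z.im|) := by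
    intro z
    have h := hE.norm_le hbd (z - H * I)
    simp only [sub_add_cancel] at h
    refine h.trans ?_
    rw [mul_assoc (B * _), ← Real.exp_add (Real.pi * H), ← mul_add]
    have : |(z - H * I).im| ≤ H + |z.im| := by
      simpa [abs_of_pos hH, add_comm] using abs_sub z.im H
    gcongr
  obtain ⟨ψ, C, hψ, hφψ, hC, hψC⟩ := exists_eq_mul_sinProd hβ hS hφ.expType.1 hφM
    fun z h => (hz z).2 h
  -- A zero of `ψ` would be a zero of `φ` where the sine product vanishes too, hence a multiple zero
  -- of `φ`.
  have hψ0 : ∀ z, ψ z ≠ 0 := by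
    intro z h0
    by_cases h : φ z = 0
    · refine hφ.simple_zeros z h ?_
      have hfun : φ = fun w => ψ w * sinProd β S w := funext hφψ
      rw [hfun, ((hψ z).hasDerivAt.fun_mul (differentiable_sinProd β S z).hasDerivAt).deriv, h0,
        (hz z).1 h]
      simp
    · exact h (by rw [hφψ, h0, zero_mul])
  set δ := Real.pi - S.card * (Real.pi / β) with hδdef
  have hδ : 0 < δ := by
    rw [hδdef, sub_pos, ← mul_div_assoc, div_lt_iff₀ hβ, mul_comm]
    gcongr
  obtain ⟨a, b, hab⟩ := exists_eq_exp_affine hψ hψ0 hδ.le hC hψC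
  obtain ⟨d, hd, hup⟩ := exists_norm_sinProd_le hβ S
  have hlow : ∀ z : ℂ, H ≤ |z.im| → A / d * Real.exp (δ * |z.im|) ≤ ‖ψ z‖ := by
    intro z hz
    have h1 := (hgr z hz).1
    rw [hφψ, norm_mul] at h1
    have h2 : A * Real.exp (Real.pi * |z.im|) ≤
        ‖ψ z‖ * (d * Real.exp (S.card * (Real.pi / β) * |z.im|)) :=
      h1.trans (by gcongr; exact hup z)
    have h4 : Real.pi * |z.im| = δ * |z.im| + S.card * (Real.pi / β) * |z.im| := by
      rw [hδdef]; ring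
    rw [h4, Real.exp_add, ← mul_assoc, ← mul_assoc] at h2
    have h5 := le_of_mul_le_mul_right h2 (Real.exp_pos _)
    rw [div_mul_eq_mul_div, div_le_iff₀ hd]
    exact h5
  -- The linear terms of the exponent cancel at `y I` and `-(y I)`, so the product of the two values
  -- stays constant although both lower bounds grow like `e^{δy}`.
  have hprod : ∀ y : ℝ, H ≤ y → A / d * Real.exp (δ * y) * (A / d * Real.exp (δ * y)) ≤
      Real.exp (2 * a.re) := by
    intro y hy
    have hy0 : |y| = y := abs_of_pos (hH.trans_le hy)
    have h1 := hlow (y * I) (by simpa [hy0] using hy)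
    have h2 := hlow (-(y * I)) (by simpa [hy0] using hy)
    have h3 : ‖ψ (y * I)‖ * ‖ψ (-(y * I))‖ = Real.exp (2 * a.re) := by
      rw [← norm_mul, hab, hab, ← exp_add, Complex.norm_exp]
      congr 1
      have : a + b * (y * I) + (a + b * -(y * I)) = 2 * a := by ring
      rw [this]
      simp
    rw [← h3]
    have e1 : |((y : ℂ) * I).im| = y := by simpa using hy0
    have e2 : |(-((y : ℂ) * I)).im| = y := by simpa using hy0
    rw [e1] at h1
    rw [e2] at h2
    exact mul_le_mul h1 h2 (by positivity) (norm_nonneg _)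
  have ht : Tendsto (fun y : ℝ => A / d * Real.exp (δ * y)) atTop atTop :=
    (Real.tendsto_exp_atTop.comp (tendsto_id.const_mul_atTop hδ)).const_mul_atTop (by positivity)
  obtain ⟨y, hy1, hy2⟩ := (((ht.atTop_mul_atTop₀ ht).eventually_gt_atTop
    (Real.exp (2 * a.re))).and (eventually_ge_atTop H)).exists
  exact absurd (hprod y hy2) (not_le.2 hy1)

/-- A function of the Bernstein space `B^p_π` that vanishes on the zeros of a product of at least
`β` sines is zero. -/
lemma BernsteinSpace.eq_zero_of_vanish {p : ENNReal} (hp : 1 ≤ p) (hp' : p < ⊤) {h : ℂ → ℂ}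
    (hh : h ∈ BernsteinSpace p Real.pi) {β : ℝ} (hβ : 0 < β) {S : Finset ℂ}
    (hS : ∀ s ∈ S, ∀ t ∈ S, ∀ n : ℤ, s = n * β + t → s = t) (hcard : β ≤ S.card)
    (hz : ∀ z, sinProd β S z = 0 → h z = 0) (z : ℂ) : h z = 0 := by
  obtain ⟨M, hM⟩ := BernsteinSpace.bounded hp hp' Real.pi_pos.le hh
  obtain ⟨u, C, hu, hhu, hC, huC⟩ := exists_eq_mul_sinProd hβ hS hh.1.1 (hh.1.norm_le hM) hz
  have hub : ∀ z, ‖u z‖ ≤ C := by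
    intro z
    refine (huC z).trans (mul_le_of_le_one_right hC.le (Real.exp_le_one_iff.2 ?_))
    refine mul_nonpos_of_nonpos_of_nonneg ?_ (abs_nonneg _)
    rw [sub_nonpos, ← mul_div_assoc, le_div_iff₀ hβ, mul_comm]
    gcongr
  have huc : ∀ z, u z = u 0 := fun z =>
    hu.apply_eq_apply_of_bounded (isBounded_iff_forall_norm_le.2 ⟨C, by
      rintro _ ⟨w, rfl⟩; exact hub w⟩) z 0
  suffices u 0 = 0 by rw [hhu, huc, this, zero_mul]
  by_contra hu0
  obtain ⟨x₀, hx₀⟩ := exists_re_sinProd_ne_zero hβ S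
  have hp0 : p ≠ 0 := (zero_lt_one.trans_le hp).ne'
  have hpr : 0 < p.toReal := ENNReal.toReal_pos hp0 hp'.ne
  set k : ℝ → ℝ := fun t => ‖h t‖ ^ p.toReal with hk
  have hint : MeasureTheory.Integrable k := hh.2.integrable_norm_rpow hp0 hp'.ne
  have hkc : Continuous k :=
    (hh.1.1.continuous.comp continuous_ofReal).norm.rpow_const fun _ => Or.inr hpr.le
  have hk0 : ∀ t, 0 ≤ k t := fun t => by positivity
  -- A periodic function with positive integral over a period is not integrable on the line.
  have hper : Function.Periodic k β := by
    intro t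
    have := norm_sinProd_add_zsmul hβ S t 1
    simp only [hk, hhu, huc, norm_mul]
    push_cast at this ⊢
    rw [one_mul] at this
    rw [this]
  have hpos : 0 < ∫ t in (0 : ℝ)..β, k t := by
    have h1 := hper.intervalIntegral_add_eq x₀ 0
    rw [zero_add] at h1
    rw [← h1]
    refine intervalIntegral.integral_pos (by linarith) hkc.continuousOn (fun t _ => hk0 t)
      ⟨x₀, ⟨le_rfl, by linarith⟩, ?_⟩
    refine Real.rpow_pos_of_pos (norm_pos_iff.2 ?_) _
    rw [hhu, huc]
    exact mul_ne_zero hu0 (hx₀ _ (ofReal_re _))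
  have ht := hper.tendsto_atTop_intervalIntegral_of_pos hpos hβ
  obtain ⟨T, hT, hT0⟩ := ((ht.eventually_gt_atTop (∫ t, k t)).and (eventually_ge_atTop 0)).exists
  refine absurd hT (not_lt.2 ?_)
  rw [intervalIntegral.integral_of_le hT0]
  exact MeasureTheory.setIntegral_le_integral hint (Eventually.of_forall hk0)

end PhaseRetrieval

/-! ### Phase retrieval in `ℂ^K` -/

namespace PhaseRetrieval

open Complex ComplexConjugate

lemma inner_eq_sum {K : ℕ} (a x : EuclideanSpace ℂ (Fin K)) :
    inner ℂ a x = ∑ k, conj (a k) * x k := by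
  rw [PiLp.inner_apply]
  exact Finset.sum_congr rfl fun k _ => by rw [RCLike.inner_apply, mul_comm]

/-- Tightness summed over the standard basis gives `∑ ‖a i‖² = K²`, shared equally by `K²` vectors.
-/
lemma IsTwoUniformTightFrame.norm_eq_one {K : ℕ} (hK : 2 ≤ K)
    {a : Fin (K ^ 2) → EuclideanSpace ℂ (Fin K)}
    (ha : IsTwoUniformTightFrame ((K : ℝ) ^ 2 / (K : ℝ)) a) (i : Fin (K ^ 2)) : ‖a i‖ = 1 := by
  obtain ⟨b, hb⟩ := ha.uniform
  have hK0 : (K : ℝ) ≠ 0 := by positivity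
  have h1 : ∀ k : Fin K, ∑ i, ‖a i k‖ ^ 2 = (K : ℝ) := by
    intro k
    have h := ha.tight (EuclideanSpace.single k 1)
    simp only [EuclideanSpace.inner_single_right, PiLp.norm_single] at h
    rw [pow_two (K : ℝ), mul_div_cancel_right₀ _ hK0] at h
    simpa using h
  have h2 : ∑ i, ‖a i‖ ^ 2 = (K : ℝ) * K := by
    simp_rw [EuclideanSpace.norm_sq_eq]
    rw [Finset.sum_comm]
    simp [h1]
  have hb0 : 0 ≤ b := (hb i) ▸ norm_nonneg _
  simp only [hb, Finset.sum_const, Finset.card_univ, Fintype.card_fin, nsmul_eq_mul] at h2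
  rw [hb]
  push_cast at h2
  have h3 : b ^ 2 = 1 := by
    have : (K : ℝ) ^ 2 ≠ 0 := by positivity
    apply mul_left_cancel₀ this
    linarith
  nlinarith

/-- Tightness tested on a frame vector gives the equation for `u`; `u = 1` would force `K² = K`. -/
lemma IsTwoUniformTightFrame.exists_norm_inner_sq {K : ℕ} (hK : 2 ≤ K)
    {a : Fin (K ^ 2) → EuclideanSpace ℂ (Fin K)}
    (ha : IsTwoUniformTightFrame ((K : ℝ) ^ 2 / (K : ℝ)) a) :
    ∃ u : ℝ, u ≠ 1 ∧ 1 + ((K : ℝ) ^ 2 - 1) * u = K ∧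
      ∀ i j, ‖inner ℂ (a i) (a j)‖ ^ 2 = u + if i = j then 1 - u else 0 := by
  obtain ⟨c, hc⟩ := ha.equiangular
  have hK0 : (K : ℝ) ≠ 0 := by positivity
  have hform : ∀ i j, ‖inner ℂ (a i) (a j)‖ ^ 2 = c ^ 2 + if i = j then 1 - c ^ 2 else 0 := by
    intro i j
    split_ifs with h
    · subst h
      rw [inner_self_eq_norm_sq_to_K, ha.norm_eq_one hK]
      simp
    · rw [hc i j h, add_zero]
  have hsum : 1 + ((K : ℝ) ^ 2 - 1) * c ^ 2 = K := by
    have h := ha.tight (a ⟨0, by positivity⟩)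
    rw [ha.norm_eq_one hK, pow_two (K : ℝ), mul_div_cancel_right₀ _ hK0] at h
    simp only [hform, Finset.sum_add_distrib, Finset.sum_const, Finset.card_univ,
      Fintype.card_fin, nsmul_eq_mul, Finset.sum_ite_eq', Finset.mem_univ, if_true] at h
    push_cast at h
    linarith
  refine ⟨c ^ 2, fun h1 => ?_, hsum, hform⟩
  have : (2 : ℝ) ≤ K := by exact_mod_cast hK
  rw [h1] at hsum
  nlinarith

/-- Squared moduli of the frame coefficients determine a vector up to a unimodular factor. -/
lemma IsTwoUniformTightFrame.mul_conj_eq {K : ℕ} (hK : 2 ≤ K)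
    {a : Fin (K ^ 2) → EuclideanSpace ℂ (Fin K)}
    (ha : IsTwoUniformTightFrame ((K : ℝ) ^ 2 / (K : ℝ)) a) {x y : EuclideanSpace ℂ (Fin K)}
    (hxy : ∀ m, ‖inner ℂ (a m) x‖ ^ 2 = ‖inner ℂ (a m) y‖ ^ 2) (i k : Fin K) :
    x i * conj (x k) = y i * conj (y k) := by
  classical
  obtain ⟨u, hu1, hsum, hform⟩ := ha.exists_norm_inner_sq hK
  -- `R v` is the matrix `v v*`, `V` forms combinations of the `R (a m)`, and `L` pairs a matrix
  -- with each `R (a j)`. Thus `L ∘ V` is the Gram matrix `(1 - u) I + u J`.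
  let R : EuclideanSpace ℂ (Fin K) → Fin K × Fin K → ℂ := fun v q => v q.1 * conj (v q.2)
  let V : (Fin (K ^ 2) → ℂ) →ₗ[ℂ] (Fin K × Fin K → ℂ) :=
    { toFun := fun c => ∑ m, c m • R (a m)
      map_add' := fun c d => by simp [add_smul, Finset.sum_add_distrib]
      map_smul' := fun c d => by simp [Finset.smul_sum, smul_smul] }
  let L : (Fin K × Fin K → ℂ) →ₗ[ℂ] (Fin (K ^ 2) → ℂ) :=
    { toFun := fun Q j => ∑ q : Fin K × Fin K, conj (a j q.1) * Q q * a j q.2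
      map_add' := fun c d => by
        funext j; simp [mul_add, add_mul, Finset.sum_add_distrib]
      map_smul' := fun c d => by
        funext j
        simp only [Pi.smul_apply, smul_eq_mul, RingHom.id_apply, Finset.mul_sum]
        exact Finset.sum_congr rfl fun q _ => by ring }
  have hLR : ∀ v j, L (R v) j = ((‖inner ℂ (a j) v‖ ^ 2 : ℝ) : ℂ) := by
    intro v j
    have h1 : ((‖inner ℂ (a j) v‖ ^ 2 : ℝ) : ℂ) = inner ℂ (a j) v * conj (inner ℂ (a j) v) := by
      rw [Complex.mul_conj']; push_cast; rfl
    rw [h1, inner_eq_sum, map_sum, Finset.sum_mul_sum]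
    change ∑ q : Fin K × Fin K, conj (a j q.1) * (v q.1 * conj (v q.2)) * a j q.2 = _
    rw [Fintype.sum_prod_type]
    refine Finset.sum_congr rfl fun p _ => Finset.sum_congr rfl fun q _ => ?_
    rw [map_mul, Complex.conj_conj]
    ring
  have hLV : ∀ c, L (V c) = 0 → c = 0 := by
    intro c hc
    have h1 : ∀ j, (u : ℂ) * ∑ m, c m + (1 - u) * c j = 0 := by
      intro j
      have h2 : L (V c) j = ∑ m, c m * L (R (a m)) j := by
        change L (∑ m, c m • R (a m)) j = _
        rw [map_sum, Finset.sum_apply]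
        exact Finset.sum_congr rfl fun m _ => by rw [map_smul, Pi.smul_apply, smul_eq_mul]
      rw [hc, Pi.zero_apply] at h2
      rw [h2]
      simp only [hLR, hform]
      push_cast
      simp only [apply_ite (fun r : ℝ => (r : ℂ))]
      simp [mul_add, Finset.sum_add_distrib, ← Finset.sum_mul]
      ring
    -- Summing over all `K²` indices `j` gives `(1 + (K² - 1) u) ∑ c = K ∑ c`.
    have h3 : ∑ m, c m = 0 := by
      have h4 : ∑ j, ((u : ℂ) * ∑ m, c m + (1 - u) * c j) = 0 :=
        Finset.sum_eq_zero fun j _ => h1 j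
      rw [Finset.sum_add_distrib, ← Finset.mul_sum, ← Finset.mul_sum] at h4
      simp only [Finset.sum_const, Finset.card_univ, Fintype.card_fin, nsmul_eq_mul] at h4
      push_cast at h4
      have h5 : (1 + ((K : ℂ) ^ 2 - 1) * u) = K := by exact_mod_cast congrArg Complex.ofReal hsum
      have h6 : (K : ℂ) * ∑ m, c m = 0 := by
        rw [← h5]
        linear_combination h4
      exact (mul_eq_zero.1 h6).resolve_left (Nat.cast_ne_zero.2 (by omega))
    funext j
    have h7 := h1 j
    rw [h3, mul_zero, zero_add] at h7
    refine (mul_eq_zero.1 h7).resolve_left fun h8 => hu1 ?_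
    have : (u : ℂ) = 1 := by linear_combination -h8
    exact_mod_cast this
  have hVinj : Function.Injective V := by
    rw [← LinearMap.ker_eq_bot, LinearMap.ker_eq_bot']
    intro c hc
    exact hLV c (by rw [hc, map_zero])
  -- Both spaces have dimension `K²`, so `R x - R y` is a combination of the `R (a m)`; `L` kills
  -- it, hence it is zero.
  have hVsurj : Function.Surjective V := by
    refine (LinearMap.injective_iff_surjective_of_finrank_eq_finrank ?_).1 hVinj
    simp [pow_two]
  obtain ⟨c, hc⟩ := hVsurj (R x - R y)
  have h0 : L (V c) = 0 := by
    rw [hc, map_sub, sub_eq_zero]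
    funext j
    rw [hLR, hLR, hxy]
  rw [hLV c h0, map_zero] at hc
  have := congrFun hc (i, k)
  simp only [R, Pi.zero_apply, Pi.sub_apply] at this
  linear_combination -this

lemma exists_unimodular_of_mul_conj_eq {ι : Type*} {x y : ι → ℂ}
    (h : ∀ i k, x i * conj (x k) = y i * conj (y k)) {k : ι} (hk : y k ≠ 0) :
    ‖x k / y k‖ = 1 ∧ ∀ i, x i = x k / y k * y i := by
  have h1 : ‖x k‖ = ‖y k‖ := by
    have := congrArg norm (h k k)
    simp only [norm_mul, RCLike.norm_conj] at this
    nlinarith [norm_nonneg (x k), norm_nonneg (y k)]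
  have hxk : x k ≠ 0 := by
    rw [← norm_ne_zero_iff, h1]
    exact norm_ne_zero_iff.2 hk
  refine ⟨by rw [norm_div, h1, div_self (norm_ne_zero_iff.2 hk)], fun i => ?_⟩
  have hc : conj (x k) ≠ 0 := (map_ne_zero _).2 hxk
  apply mul_right_cancel₀ hc
  rw [h i k]
  have h2 := h k k
  field_simp
  linear_combination (-y i) * h2

/-! ### From blocks of samples to signals -/

/-- Representatives modulo `β` of the sampling set. -/
lemma exists_sinProd_samplingSet {K : ℕ} {β : ℝ} (hβ : 0 < β) (lam : Fin K → ℂ) :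
    ∃ S : Finset ℂ, S.card ≤ K - 1 ∧
      (∀ s ∈ S, ∀ t ∈ S, ∀ n : ℤ, s = n * β + t → s = t) ∧
      ∀ z, sinProd β S z = 0 ↔ z ∈ samplingSet β lam := by
  classical
  -- Congruent `λ_k` must share one representative, since a repeated sine would give double zeros.
  let r : ℂ → ℂ := fun z => (QuotientAddGroup.mk z : ℂ ⧸ AddSubgroup.zmultiples (β : ℂ)).out
  have hr : ∀ z w, r z = r w ↔ ∃ n : ℤ, z = n * β + w := by
    intro z w
    simp only [r, Quotient.out_inj]
    rw [QuotientAddGroup.eq, AddSubgroup.mem_zmultiples_iff]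
    constructor
    · rintro ⟨n, hn⟩
      refine ⟨-n, ?_⟩
      rw [zsmul_eq_mul] at hn
      push_cast
      linear_combination hn
    · rintro ⟨n, rfl⟩
      refine ⟨-n, ?_⟩
      rw [zsmul_eq_mul]
      push_cast
      ring
  have hrr : ∀ z, r (r z) = r z := fun z => by
    simp only [r]
    rw [QuotientAddGroup.out_eq']
  let T : Finset (Fin K) := Finset.univ.filter fun k => (k : ℕ) + 1 < K
  refine ⟨T.image fun k => r (lam k), ?_, ?_, fun z => ?_⟩
  · refine Finset.card_image_le.trans ?_
    have h1 : T.card ≤ (Finset.range (K - 1)).card :=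
      Finset.card_le_card_of_injOn (fun k => (k : ℕ))
        (fun k hk => by
          have : (k : ℕ) + 1 < K := by simpa [T] using hk
          simp only [Finset.coe_range, Set.mem_Iio]
          omega)
        (fun _ _ _ _ h => Fin.ext h)
    simpa using h1
  · intro s hs t ht n hst
    obtain ⟨k, _, rfl⟩ := Finset.mem_image.1 hs
    obtain ⟨l, _, rfl⟩ := Finset.mem_image.1 ht
    rw [← hrr (lam k), ← hrr (lam l)]
    exact (hr _ _).2 ⟨n, hst⟩
  · rw [sinProd_eq_zero_iff hβ]
    have hz : ∀ k, (∃ n : ℤ, z = n * β + r (lam k)) ↔ ∃ n : ℤ, z = n * β + lam k := fun k => by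
      rw [← hr, ← hr, hrr]
    constructor
    · rintro ⟨s, hs, hn⟩
      obtain ⟨k, hk, rfl⟩ := Finset.mem_image.1 hs
      obtain ⟨n, hn⟩ := (hz k).1 hn
      exact ⟨n, k, (Finset.mem_filter.1 hk).2, hn⟩
    · rintro ⟨n, k, hk, hn⟩
      exact ⟨r (lam k), Finset.mem_image_of_mem _ (Finset.mem_filter.2 ⟨Finset.mem_univ _, hk⟩),
        (hz k).2 ⟨n, hn⟩⟩

/-- Under the recovery condition the sampling set is the zero set of a product of at least `β`
and at most `K - 1` sines. -/
lemma RecoveryCondition.exists_sinProd {K : ℕ} {hK : 2 ≤ K} {β : ℝ} (hβ : 0 < β) {lam : Fin K → ℂ}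
    {α : Fin K → Fin (K ^ 2) → ℂ} (h : RecoveryCondition hK β lam α) :
    ∃ S : Finset ℂ, S.card ≤ K - 1 ∧ β ≤ S.card ∧
      (∀ s ∈ S, ∀ t ∈ S, ∀ n : ℤ, s = n * β + t → s = t) ∧
      ∀ z, sinProd β S z = 0 ↔ z ∈ samplingSet β lam := by
  obtain ⟨S, hc, hS, hz⟩ := exists_sinProd_samplingSet hβ lam
  obtain ⟨φ, hφ, hφz⟩ := h.zeroSet
  refine ⟨S, hc, hφ.le_card hβ hS fun z => ?_, hS, hz⟩
  rw [hz, hφz]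
  rfl

lemma measurement_eq_inner {K : ℕ} (β : ℝ) (lam : Fin K → ℂ) (α : Fin K → Fin (K ^ 2) → ℂ)
    (n : ℤ) (m : Fin (K ^ 2)) (f : ℂ → ℂ) :
    measurement β lam α n m f =
      inner ℂ (coeffVector α m) (WithLp.toLp 2 fun k => f (n * β + lam k)) := by
  rw [inner_eq_sum]
  rfl

/-- Phase retrieval from the intensity measurements. -/
lemma RecoveryCondition.unique {K : ℕ} {hK : 2 ≤ K} {β : ℝ} (hβ : 0 < β) {lam : Fin K → ℂ}
    {α : Fin K → Fin (K ^ 2) → ℂ} (h : RecoveryCondition hK β lam α) {p : ENNReal}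
    (hp : 1 < p) (hp' : p < ⊤) {f g : ℂ → ℂ}
    (hf : f ∈ recoverableSignals p β (lam ⟨0, by omega⟩)) (hg : g ∈ BernsteinSpace p Real.pi)
    (hfg : ∀ n m, ‖measurement β lam α n m g‖ ^ 2 = ‖measurement β lam α n m f‖ ^ 2) :
    ∃ c : ℂ, ‖c‖ = 1 ∧ ∀ z, g z = c * f z := by
  obtain ⟨S, -, hβS, hS, hz⟩ := h.exists_sinProd hβ
  set k₀ : Fin K := ⟨0, by omega⟩ with hk₀
  let c : ℤ → ℂ := fun n => g (n * β + lam k₀) / f (n * β + lam k₀)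
  have hloc : ∀ n : ℤ, ‖c n‖ = 1 ∧ ∀ k, g (n * β + lam k) = c n * f (n * β + lam k) := by
    intro n
    refine exists_unimodular_of_mul_conj_eq (x := fun k => g (n * β + lam k))
      (y := fun k => f (n * β + lam k)) (fun i k => ?_) (hf.2 n)
    refine h.frame.mul_conj_eq hK (x := WithLp.toLp 2 fun k => g (n * β + lam k))
      (y := WithLp.toLp 2 fun k => f (n * β + lam k)) (fun m => ?_) i k
    rw [← measurement_eq_inner, ← measurement_eq_inner, hfg]
  -- The last node of block `n` is the first node of block `n + 1`, and `f` does not vanish there.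
  have hstep : ∀ n : ℤ, c (n + 1) = c n := by
    intro n
    have h1 := (hloc n).2 ⟨K - 1, by omega⟩
    have h2 := (hloc (n + 1)).2 k₀
    have e : (n : ℂ) * β + lam ⟨K - 1, by omega⟩ = ((n + 1 : ℤ) : ℂ) * β + lam k₀ := by
      rw [h.overlap]; push_cast; ring
    rw [e, h2] at h1
    exact mul_right_cancel₀ (hf.2 (n + 1)) h1
  have hconst : ∀ n : ℤ, c n = c 0 := by
    intro n
    induction n using Int.induction_on with
    | zero => rfl
    | succ i hi => rw [hstep, hi]
    | pred i hi => rw [← hi, ← hstep (-i - 1), sub_add_cancel]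
  refine ⟨c 0, (hloc 0).1, fun z => ?_⟩
  refine sub_eq_zero.1 (BernsteinSpace.eq_zero_of_vanish hp.le hp'
    (BernsteinSpace.sub_const_mul hf.1 hg (c 0)) hβ hS hβS (fun w hw => ?_) z)
  obtain ⟨n, k, -, rfl⟩ := (hz w).1 hw
  rw [(hloc n).2 k, hconst, sub_self]

lemma RecoveryCondition.four_le_overallRate {K : ℕ} {hK : 2 ≤ K} {β : ℝ} (hβ : 0 < β)
    {lam : Fin K → ℂ} {α : Fin K → Fin (K ^ 2) → ℂ} (h : RecoveryCondition hK β lam α) :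
    4 ≤ overallRate K β := by
  obtain ⟨S, hc, hβS, -⟩ := h.exists_sinProd hβ
  have h1 : (S.card : ℝ) ≤ K - 1 := by
    have : (S.card : ℝ) ≤ (K - 1 : ℕ) := by exact_mod_cast hc
    rwa [Nat.cast_sub (by omega), Nat.cast_one] at this
  rw [overallRate, le_div_iff₀ hβ]
  nlinarith [sq_nonneg ((K : ℝ) - 2)]

/-! ### The optimal example -/

/-- `sin (π z)` is a sine-type function. -/
lemma isSineType_sinProd_one : IsSineType (sinProd 1 {0}) := by
  have hzero : ∀ z, sinProd 1 {0} z = 0 ↔ ∃ n : ℤ, z = n := fun z => by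
    simp [sinProd_eq_zero_iff one_pos]
  obtain ⟨b, hb, hup⟩ := exists_norm_sinProd_le one_pos {0}
  obtain ⟨a, H, ha, hH, hlow⟩ := exists_le_norm_sinProd one_pos {0}
  simp only [Finset.card_singleton, Nat.cast_one, one_mul, div_one] at hup hlow
  refine ⟨⟨differentiable_sinProd _ _, fun ε hε => ⟨b, fun z => (hup z).trans ?_⟩⟩,
    fun z => deriv_sinProd_ne_zero one_pos (by simp), ⟨1, one_pos, ?_⟩,
    a, b, H, ha, hb, hH, fun z hz => ⟨hlow z hz, hup z⟩⟩
  · gcongr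
    · linarith
    · exact abs_im_le_norm z
  · intro z w hz hw hne
    obtain ⟨n, rfl⟩ := (hzero z).1 hz
    obtain ⟨m, rfl⟩ := (hzero w).1 hw
    have h1 : n - m ≠ 0 := fun h => hne (by rw [sub_eq_zero.1 h])
    have h2 : (1 : ℝ) ≤ |((n - m : ℤ) : ℝ)| := by exact_mod_cast Int.one_le_abs h1
    have h3 : ((n : ℂ) - m) = (((n - m : ℤ) : ℝ) : ℂ) := by push_cast; ring
    rwa [h3, Complex.norm_real, Real.norm_eq_abs]

/-- Four vectors in `ℂ²`; for `s = 1 / √3`, `t = √2` and a primitive third root of unity `w` these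
are equiangular unit vectors, the vertices of a regular tetrahedron on the Bloch sphere. -/
noncomputable def tetrahedron (s t w : ℂ) : Fin 2 → Fin (2 ^ 2) → ℂ :=
  ![![1, s, s, s], ![0, s * t, s * t * w, s * t * w ^ 2]]

/-- Encoding `s`, `t`, `w` by polynomial relations and their conjugates reduces every frame
condition to a polynomial identity. -/
lemma isTwoUniformTightFrame_tetrahedron {s t w : ℂ} (hs : s ^ 2 = 1 / 3) (ht : t ^ 2 = 2)
    (hw : w ^ 2 + w + 1 = 0) (hsc : conj s = s) (htc : conj t = t) (hw' : conj w = w ^ 2) :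
    IsTwoUniformTightFrame (((2 : ℕ) : ℝ) ^ 2 / ((2 : ℕ) : ℝ))
      (coeffVector (tetrahedron s t w)) := by
  have hnorm : ∀ z : ℂ, ((‖z‖ ^ 2 : ℝ) : ℂ) = z * conj z := fun z => by
    rw [Complex.mul_conj']; push_cast; rfl
  have hinner : ∀ m x, inner ℂ (coeffVector (tetrahedron s t w) m) x =
      conj (tetrahedron s t w 0 m) * x 0 + conj (tetrahedron s t w 1 m) * x 1 := fun m x => by
    rw [inner_eq_sum, Fin.sum_univ_two]; rfl
  have hT : tetrahedron s t w = ![![1, s, s, s], ![0, s * t, s * t * w, s * t * w ^ 2]] := rfl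
  refine ⟨fun x => ?_, ⟨1, fun i => ?_⟩, ⟨‖s‖, fun i j hij => ?_⟩⟩
  · apply Complex.ofReal_injective
    have hterm : ∀ i, ((‖inner ℂ (coeffVector (tetrahedron s t w) i) x‖ ^ 2 : ℝ) : ℂ) =
        (conj (tetrahedron s t w 0 i) * x 0 + conj (tetrahedron s t w 1 i) * x 1) *
          conj (conj (tetrahedron s t w 0 i) * x 0 + conj (tetrahedron s t w 1 i) * x 1) :=
      fun i => by rw [hnorm, hinner]
    rw [ofReal_sum, ofReal_mul, EuclideanSpace.norm_sq_eq, Fin.sum_univ_two, ofReal_add,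
      Finset.sum_congr rfl fun i _ => hterm i, hnorm, hnorm, hT]
    change ∑ i : Fin 4, _ = _
    simp [Fin.sum_univ_four, hsc, htc, hw']
    -- The identity holds with the conjugates as independent variables.
    generalize conj (x 0) = y₀
    generalize conj (x 1) = y₁
    grind
  · rw [← sq_eq_sq₀ (norm_nonneg _) zero_le_one]
    apply Complex.ofReal_injective
    rw [EuclideanSpace.norm_sq_eq, Fin.sum_univ_two, ofReal_add]
    simp only [hnorm]
    change tetrahedron s t w 0 i * conj (tetrahedron s t w 0 i) +
      tetrahedron s t w 1 i * conj (tetrahedron s t w 1 i) = _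
    rw [hT]
    fin_cases i <;> simp [hsc, htc, hw']
    all_goals grind
  · rw [← sq_eq_sq₀ (norm_nonneg _) (norm_nonneg _)]
    apply Complex.ofReal_injective
    rw [hnorm, hnorm, hinner]
    change (conj (tetrahedron s t w 0 i) * tetrahedron s t w 0 j +
      conj (tetrahedron s t w 1 i) * tetrahedron s t w 1 j) *
      conj (conj (tetrahedron s t w 0 i) * tetrahedron s t w 0 j +
      conj (tetrahedron s t w 1 i) * tetrahedron s t w 1 j) = _
    rw [hT]
    fin_cases i <;> fin_cases j <;> first | exact absurd rfl hij | skip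
    all_goals simp [hsc, htc, hw']
    all_goals grind

lemma exists_recoveryCondition_two : ∃ (lam : Fin 2 → ℂ) (α : Fin 2 → Fin (2 ^ 2) → ℂ),
    RecoveryCondition le_rfl 1 lam α := by
  obtain ⟨w, hw, hw'⟩ : ∃ w : ℂ, w ^ 2 + w + 1 = 0 ∧ conj w = w ^ 2 := by
    have h3 : (√3 : ℝ) ^ 2 = 3 := Real.sq_sqrt (by norm_num)
    refine ⟨⟨-1 / 2, √3 / 2⟩, ?_, ?_⟩ <;> apply Complex.ext <;> simp [pow_two] <;> nlinarith
  refine ⟨![0, 1], tetrahedron ((√3 : ℝ) : ℂ)⁻¹ ((√2 : ℝ) : ℂ) w, ⟨by simp, ?_, ?_⟩⟩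
  · refine ⟨_, isSineType_sinProd_one, ?_⟩
    ext z
    rw [Set.mem_ofPred_eq, sinProd_eq_zero_iff one_pos]
    constructor
    · rintro ⟨n, k, hk, rfl⟩
      have : k = 0 := Fin.ext (by simpa using hk)
      subst this
      exact ⟨0, by simp, n, by simp⟩
    · rintro ⟨s, hs, n, rfl⟩
      rw [Finset.mem_singleton.1 hs]
      exact ⟨n, 0, by simp, by simp⟩
  · refine isTwoUniformTightFrame_tetrahedron ?_ ?_ hw ?_ (conj_ofReal _) hw'
    · rw [inv_pow, ← ofReal_pow, Real.sq_sqrt (by norm_num)]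
      norm_num
    · rw [← ofReal_pow, Real.sq_sqrt (by norm_num)]
      norm_num
    · rw [map_inv₀, conj_ofReal]

end PhaseRetrieval

theorem theorem20 :
    (∀ (K : ℕ) (hK : 2 ≤ K) (β : ℝ) (lam : Fin K → ℂ) (α : Fin K → Fin (K ^ 2) → ℂ),
      0 < β → PhaseRetrieval.RecoveryCondition hK β lam α →
      ∀ p : ENNReal, 1 < p → p < ⊤ →
      ∀ f ∈ PhaseRetrieval.recoverableSignals p β (lam ⟨0, by omega⟩),
      ∀ g ∈ PhaseRetrieval.BernsteinSpace p Real.pi,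
        (∀ (n : ℤ) (m : Fin (K ^ 2)),
          ‖PhaseRetrieval.measurement β lam α n m g‖ ^ 2 =
            ‖PhaseRetrieval.measurement β lam α n m f‖ ^ 2) →
        ∃ c : ℂ, ‖c‖ = 1 ∧ ∀ z : ℂ, g z = c * f z) ∧
    IsLeast
      {R : ℝ | ∃ (K : ℕ) (hK : 2 ≤ K) (β : ℝ) (lam : Fin K → ℂ) (α : Fin K → Fin (K ^ 2) → ℂ),
        0 < β ∧ PhaseRetrieval.RecoveryCondition hK β lam α ∧
          R = PhaseRetrieval.overallRate K β}
      (4 * PhaseRetrieval.nyquistRate Real.pi) := by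
  have hN : 4 * PhaseRetrieval.nyquistRate Real.pi = 4 := by
    rw [PhaseRetrieval.nyquistRate, div_self Real.pi_ne_zero, mul_one]
  refine ⟨fun K hK β lam α hβ h p hp hp' f hf g hg hfg => h.unique hβ hp hp' hf hg hfg, ?_, ?_⟩
  · obtain ⟨lam, α, h⟩ := PhaseRetrieval.exists_recoveryCondition_two
    refine ⟨2, le_rfl, 1, lam, α, one_pos, h, ?_⟩
    rw [hN, PhaseRetrieval.overallRate]
    norm_num
  · rintro R ⟨K, hK, β, lam, α, hβ, h, rfl⟩
    rw [hN]
    exact h.four_le_overallRate hβ
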